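/- Base stations form a homogeneous Poisson point process $\Phi=\{x_i\}$ in $\mathbb{R}^2$ of intensity $\lambda>0$; put $r_i=\|x_i\|$. Each base station carries a fading power $h_i\ge 0$; the $h_i$ are i.i.d. with an arbitrary law of mean $1$ (not depending on $\lambda$) and are independent of $\Phi$. A user at the origin is served by the nearest base station (index $0$, at distance $r_0$), and $$\mathrm{SINR}(\lambda)=\frac{h_0L(r_0)}{\sum_{i:\,r_i>r_0}h_iL(r_i)+N_0},\qquad \mathbb{E}[\mathcal{E}(\lambda)]=\lambda\,\mathbb{E}\bigl[\log_2(1+\mathrm{SINR}(\lambda))\bigr],$$ where $N_0>0$ is the noise power and $\mathbb{E}[\mathcal{E}(\lambda)]$ is the average area spectral efficiency (ASE). The path loss $L:[0,\infty)\to[0,\infty)$ is a measurable function that is physically feasible: $L(0)=L_0<\infty$, $L(r)\le L_0$ for all $r\ge 0$, and $\gamma=\int_0^\infty rL(r)\,dr\in(0,\infty)$; moreover $L(r)\to L_0$ as $r\downarrow 0$. More generally, $L$ may be random: the link to base station $i$ has path loss $L(r_i,z_i)$, where the link states $z_i$ are i.i.d. and independent of $\Phi$ and of all the fading powers, $L$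 is jointly measurable, the above conditions $L\geq 0$, $L(0,\cdot)=L_0$, $L\le L_0$ and $L(r,\cdot)\to L_0$ hold for almost every state (with $L_0$ deterministic), and $\gamma=\mathbb{E}\bigl[\int_0^\infty rL(r,z_1)\,dr\bigr]\in(0,\infty)$. Then, as the real intensity $\lambda$ tends to infinity, $$\liminf_{\lambda\to\infty}\mathbb{E}[\mathcal{E}(\lambda)]\ \ge\ \frac{L_0}{2\pi\ln(2)\,\gamma}.$$ In particular, the limit, whenever it exists, is at least $L_0/(2\pi\ln(2)\gamma)$. -/

import Mathlib

open MeasureTheory ProbabilityTheory Filter Topology Set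
open scoped ENNReal NNReal

noncomputable section

/-- The plane in which base stations are deployed, with the Euclidean norm. -/
abbrev Plane : Type := EuclideanSpace ℝ (Fin 2)

/-- The counting measure of a configuration `x 0, x 1, …`:
`countingMeasure x B` is the number of indices `i` with `x i ∈ B`. -/
def countingMeasure (x : ℕ → Plane) : Measure Plane :=
  Measure.sum fun i => Measure.dirac (x i)

/-- `X` enumerates the points of a homogeneous Poisson point process on the plane with
intensity `l`: counts in sets of finite area are Poisson with mean `l * area`, and counts in
pairwise disjoint sets are independent. For `0 < l` such a process almost surely has infinitely
many points, so it is enumerated by `ℕ`; the order of the enumeration is arbitrary. -/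
structure IsPoissonProcess {Ω : Type*} [MeasurableSpace Ω] (P : Measure Ω)
    (l : ℝ) (X : ℕ → Ω → Plane) : Prop where
  measurable : ∀ i, Measurable (X i)
  map_count : ∀ B : Set Plane, MeasurableSet B → volume B ≠ ∞ →
    P.map (fun ω => countingMeasure (fun i => X i ω) B) =
      (poissonMeasure (ENNReal.ofReal l * volume B).toNNReal).map (fun k : ℕ => (k : ℝ≥0∞))
  indep_count : ∀ (n : ℕ) (B : Fin n → Set Plane), (∀ j, MeasurableSet (B j)) →
    (∀ j, volume (B j) ≠ ∞) → Pairwise (fun j k => Disjoint (B j) (B k)) →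
    iIndepFun (fun j ω => countingMeasure (fun i => X i ω) (B j)) P

/-- `H` is the law of a small-scale fading power: nonnegative, with mean one. -/
structure IsUnitMeanFading (H : Measure ℝ) : Prop where
  nonneg : ∀ᵐ t ∂H, 0 ≤ t
  integrable : Integrable (fun t : ℝ => t) H
  mean : ∫ t, t ∂H = 1

/-- `γ = E[∫₀^∞ r L(r) dr]`, where the expectation is over the random link state `s` with law
`κ`, on which the path loss may depend in addition to the distance `r`. For a deterministic path
loss (for instance when the type of link states has one point) this is `∫₀^∞ r L(r) dr`. -/
def pathLossGamma {S : Type*} [MeasurableSpace S] (κ : Measure S) (L : ℝ → S → ℝ) : ℝ≥0∞ :=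
  ∫⁻ s, (∫⁻ r in Ioi (0 : ℝ), ENNReal.ofReal (r * L r s)) ∂κ

/-- Physically feasible path loss, with link states of law `κ`: `L r s` is the (nonnegative) path
loss at distance `r ≥ 0` of a link in state `s`; `L 0 = L₀`, `L r ≤ L₀` and `0 < γ < ∞`. -/
structure IsFeasiblePathLoss {S : Type*} [MeasurableSpace S] (κ : Measure S)
    (L : ℝ → S → ℝ) (L₀ : ℝ) : Prop where
  measurable : Measurable (Function.uncurry L)
  nonneg : ∀ᵐ s ∂κ, ∀ r, 0 ≤ r → 0 ≤ L r s
  at_zero : ∀ᵐ s ∂κ, L 0 s = L₀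
  le : ∀ᵐ s ∂κ, ∀ r, 0 ≤ r → L r s ≤ L₀
  gamma_pos : 0 < pathLossGamma κ L
  gamma_lt_top : pathLossGamma κ L < ∞

/-- A downlink network: base stations at the points `X i` of a Poisson process of intensity `l`;
the base station `i` has fading power `h i` and link state `z i` towards the user at the origin.
The fading powers are i.i.d. with law `H`, the link states are i.i.d. with law `κ`, and the
positions, the fading powers and the link states are independent of each other. -/
structure IsDownlinkNetwork {Ω S : Type*} [MeasurableSpace Ω] [MeasurableSpace S]
    (P : Measure Ω) (H : Measure ℝ) (κ : Measure S) (l : ℝ)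
    (X : ℕ → Ω → Plane) (h : ℕ → Ω → ℝ) (z : ℕ → Ω → S) : Prop where
  poisson : IsPoissonProcess P l X
  measurable_fading : ∀ i, Measurable (h i)
  law_fading : ∀ i, P.map (h i) = H
  indep_fading : iIndepFun h P
  measurable_state : ∀ i, Measurable (z i)
  law_state : ∀ i, P.map (z i) = κ
  indep_state : iIndepFun z P
  indep_fading_state : IndepFun (fun ω i => h i ω) (fun ω i => z i ω) P
  indep_position_marks :
    IndepFun (fun ω i => X i ω) (fun ω => ((fun i => h i ω), (fun i => z i ω))) P

/-- The index of the serving base station: the one closest to the user at the origin (almost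
surely there is exactly one; otherwise the least such index, or `0` if there is none). -/
def servingIndex (x : ℕ → Plane) : ℕ :=
  sInf {i | ∀ j, ‖x i‖ ≤ ‖x j‖}

/-- The total received power from the base stations outside the closed ball `B(0, r₀)`, where `r₀`
is the distance to the serving base station. -/
def interference {S : Type*} (L : ℝ → S → ℝ) (x : ℕ → Plane) (h : ℕ → ℝ) (z : ℕ → S) : ℝ≥0∞ :=
  ∑' i, if ‖x (servingIndex x)‖ < ‖x i‖ then ENNReal.ofReal (h i * L ‖x i‖ (z i)) else 0

/-- The signal to interference plus noise ratio at the origin, with noise power `N₀`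
(finite for `0 < N₀`). -/
def sinr {S : Type*} (L : ℝ → S → ℝ) (N₀ : ℝ) (x : ℕ → Plane) (h : ℕ → ℝ) (z : ℕ → S) : ℝ≥0∞ :=
  ENNReal.ofReal (h (servingIndex x) * L ‖x (servingIndex x)‖ (z (servingIndex x))) /
    (interference L x h z + ENNReal.ofReal N₀)

/-- The average area spectral efficiency `l * E[log₂ (1 + SINR)]`, as an element of `[0, ∞]`. -/
def averageASE {Ω S : Type*} [MeasurableSpace Ω] (P : Measure Ω) (L : ℝ → S → ℝ) (N₀ l : ℝ)
    (X : ℕ → Ω → Plane) (h : ℕ → Ω → ℝ) (z : ℕ → Ω → S) : ℝ≥0∞ :=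
  ENNReal.ofReal l * ∫⁻ ω, ENNReal.ofReal (Real.logb 2
    (1 + (sinr L N₀ (fun i => X i ω) (fun i => h i ω) (fun i => z i ω)).toReal)) ∂P

end

/-! In a dense network the interference has mean about `m = 2πγl`, while the signal tends to `h₀L₀`,
so `log (1 + SINR)` should be about `h₀L₀ / m`. For a lower bound no concentration of the
interference is needed. With `y` the interference, `N` the noise and `0 ≤ a` at most the signal,
`log (1 + a/(y+N)) ≥ a/(a+y+N)`, and the tangent to the convex function `1/w` at `w = m` gives
`a/(a+y+N) ≥ 2a/m - a(a+y+N)/m²`, which is linear in `y` (`two_mul_div_le_log_add`).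

Take `a = min(h₀,K) L(r₀)`; the truncation keeps the `a²` term finite, as the fading may lack a
second moment. Write `α = E[min(h₀,K)]`. Independence and Campbell's formula give `E[ay] ≤ L₀αm`
(`lintegral_min_mul_interference_le`, `lintegral_tsum_eq`), and void probabilities give `E[a] ≥
αcp`, with `c` near `L₀` and `p → 1` (`mul_le_lintegral_servingDistance`). Multiplying by `l / ln 2`
leaves `α(2cp - L₀)/(2π ln 2 γ)` minus `O(1/l)`. Let `l → ∞`, then `K → ∞` and `c → L₀`. -/

/-! ### Polar coordinates and the Poisson mean -/

/-- Integration of radial functions over the plane in polar coordinates. -/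
theorem lintegral_fun_norm_plane {g : ℝ → ℝ≥0∞} (hg : Measurable g) :
    ∫⁻ x : Plane, g ‖x‖ =
      ENNReal.ofReal (2 * Real.pi) * ∫⁻ r in Ioi (0 : ℝ), ENNReal.ofReal r * g r := by
  have hdim : Module.finrank ℝ Plane = 2 := by simp
  have hmp := (volume : Measure Plane).measurePreserving_homeomorphUnitSphereProd
  calc ∫⁻ x : Plane, g ‖x‖
      = ∫⁻ x : ({(0 : Plane)}ᶜ : Set Plane), g ‖x.1‖ ∂(volume.comap Subtype.val) := by
        rw [lintegral_subtype_comap (measurableSet_singleton _).compl fun x : Plane => g ‖x‖,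
          restrict_compl_singleton]
    _ = ∫⁻ x, g x.2 ∂((volume : Measure Plane).toSphere.prod
          (.volumeIoiPow (Module.finrank ℝ Plane - 1))) := by
        have := hmp.lintegral_comp (f := fun x => g (x.2 : ℝ)) (by fun_prop)
        rw [← this]
        simp
    _ = (∫⁻ _, 1 ∂(volume : Measure Plane).toSphere) *
          ∫⁻ r, g r ∂(.volumeIoiPow (Module.finrank ℝ Plane - 1)) := by
        rw [← lintegral_prod_mul (by fun_prop) (by fun_prop)]
        simp
    _ = _ := by
        rw [lintegral_one, Measure.toSphere_apply_univ, hdim, Measure.volumeIoiPow,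
          lintegral_withDensity_eq_lintegral_mul _ (by fun_prop) (by fun_prop)]
        simp only [Pi.mul_apply]
        rw [lintegral_subtype_comap measurableSet_Ioi
          fun r : ℝ => ENNReal.ofReal (r ^ (2 - 1)) * g r,
          EuclideanSpace.volume_ball_fin_two]
        congr 1
        · rw [ENNReal.ofReal_mul (by norm_num), ENNReal.ofReal_one]
          simp [ENNReal.ofReal, Real.toNNReal_of_nonneg Real.pi_pos.le]
        · simp

theorem lintegral_natCast_poissonMeasure (r : ℝ≥0) :
    ∫⁻ k : ℕ, (k : ℝ≥0∞) ∂poissonMeasure r = r := by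
  have hs : HasSum (fun k : ℕ => Real.exp (-r) * r ^ k / (k.factorial : ℝ) * k) r := by
    -- The term `k = 0` vanishes, and `k/k! = 1/(k-1)!` turns the shifted series into `r` times the
    -- total mass.
    rw [← hasSum_nat_add_iff' 1]
    have := (hasSum_one_poissonMeasure r).mul_left (r : ℝ)
    simp only [Finset.range_one, Finset.sum_singleton, Nat.cast_zero, mul_zero, sub_zero]
    rw [mul_one] at this
    refine this.congr_fun ?_ |> fun h => h
    intro k
    rw [Nat.factorial_succ]
    push_cast
    field_simp
    ring
  rw [lintegral_countable']
  simp_rw [poissonMeasure_singleton]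
  have : ∀ k : ℕ, (k : ℝ≥0∞) * ENNReal.ofReal (Real.exp (-r) * r ^ k / (k.factorial : ℝ)) =
      ENNReal.ofReal (Real.exp (-r) * r ^ k / (k.factorial : ℝ) * k) := fun k => by
    rw [ENNReal.ofReal_mul (by positivity), ENNReal.ofReal_natCast, mul_comm]
  simp_rw [this]
  rw [← ENNReal.ofReal_tsum_of_nonneg (fun k => by positivity) hs.summable, hs.tsum_eq,
    ENNReal.ofReal_coe_nnreal]

theorem countingMeasure_apply (x : ℕ → Plane) {B : Set Plane} (hB : MeasurableSet B) :
    countingMeasure x B = ∑' i, B.indicator 1 (x i) := by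
  rw [countingMeasure, Measure.sum_apply _ hB]
  simp [Measure.dirac_apply' _ hB]

/-! ### Campbell's formula and void probabilities -/

namespace IsPoissonProcess

variable {Ω : Type*} [MeasurableSpace Ω] {P : Measure Ω} {l : ℝ} {X : ℕ → Ω → Plane}

theorem measurable_count (hX : IsPoissonProcess P l X) {B : Set Plane} (hB : MeasurableSet B) :
    Measurable fun ω => countingMeasure (fun i => X i ω) B := by
  simp_rw [countingMeasure_apply _ hB]
  exact Measurable.tsum fun i => (measurable_one.indicator hB).comp (hX.measurable i)

theorem lintegral_count (hX : IsPoissonProcess P l X) {B : Set Plane} (hB : MeasurableSet B)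
    (hv : volume B ≠ ∞) :
    ∫⁻ ω, countingMeasure (fun i => X i ω) B ∂P = ENNReal.ofReal l * volume B := by
  have h := hX.map_count B hB hv
  calc ∫⁻ ω, countingMeasure (fun i => X i ω) B ∂P
      = ∫⁻ y, y ∂(P.map fun ω => countingMeasure (fun i => X i ω) B) :=
        (lintegral_map measurable_id (hX.measurable_count hB)).symm
    _ = ENNReal.ofReal l * volume B := by
        rw [h, lintegral_map (f := fun y => y) measurable_id .of_discrete,
          lintegral_natCast_poissonMeasure, ENNReal.coe_toNNReal]
        exact ENNReal.mul_ne_top ENNReal.ofReal_ne_top hv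

/-- Expected counts determine both sides on sets of finite area, a π-system generating the Borel
sets and containing the exhausting balls. -/
theorem sum_map_eq (hX : IsPoissonProcess P l X) :
    Measure.sum (fun i => P.map (X i)) = ENNReal.ofReal l • (volume : Measure Plane) := by
  have key : ∀ B : Set Plane, MeasurableSet B → volume B ≠ ∞ →
      Measure.sum (fun i => P.map (X i)) B = ENNReal.ofReal l * volume B := by
    intro B hB hv
    rw [← hX.lintegral_count hB hv, Measure.sum_apply _ hB]
    simp_rw [countingMeasure_apply _ hB]
    rw [lintegral_tsum (f := fun i ω => B.indicator 1 (X i ω)) fun i =>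
      ((measurable_one.indicator hB).comp (hX.measurable i)).aemeasurable]
    refine tsum_congr fun i => ?_
    rw [Measure.map_apply (hX.measurable i) hB,
      ← lintegral_indicator_one (hX.measurable i hB)]
    rfl
  refine Measure.ext_of_generateFrom_of_iUnion {B | MeasurableSet B ∧ volume B ≠ ∞}
    (fun n => Metric.ball (0 : Plane) n) ?_ ?_ ?_ ?_ ?_ ?_
  · refine le_antisymm ?_ (MeasurableSpace.generateFrom_le fun B hB => hB.1)
    intro B hB
    have : B = ⋃ n : ℕ, B ∩ Metric.ball (0 : Plane) n := by
      rw [← inter_iUnion, Metric.iUnion_ball_nat, inter_univ]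
    rw [this]
    refine MeasurableSet.iUnion fun n => MeasurableSpace.measurableSet_generateFrom
      ⟨hB.inter measurableSet_ball, ?_⟩
    exact ne_top_of_le_ne_top measure_ball_lt_top.ne (measure_mono inter_subset_right)
  · rintro A hA B hB -
    exact ⟨hA.1.inter hB.1, ne_top_of_le_ne_top hA.2 (measure_mono inter_subset_left)⟩
  · exact Metric.iUnion_ball_nat 0
  · exact fun n => ⟨measurableSet_ball, measure_ball_lt_top.ne⟩
  · intro n
    rw [key _ measurableSet_ball measure_ball_lt_top.ne]
    exact ENNReal.mul_ne_top ENNReal.ofReal_ne_top measure_ball_lt_top.ne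
  · rintro B ⟨hB, hv⟩
    rw [key B hB hv]
    rfl

/-- Campbell's formula. -/
theorem lintegral_tsum_eq (hX : IsPoissonProcess P l X) {f : Plane → ℝ≥0∞} (hf : Measurable f) :
    ∫⁻ ω, ∑' i, f (X i ω) ∂P = ENNReal.ofReal l * ∫⁻ x, f x := by
  rw [lintegral_tsum (f := fun i ω => f (X i ω)) fun i => (hf.comp (hX.measurable i)).aemeasurable]
  calc ∑' i, ∫⁻ ω, f (X i ω) ∂P = ∑' i, ∫⁻ x, f x ∂(P.map (X i)) :=
        tsum_congr fun i => (lintegral_map hf (hX.measurable i)).symm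
    _ = ∫⁻ x, f x ∂(Measure.sum fun i => P.map (X i)) := (lintegral_sum_measure _ _).symm
    _ = _ := by rw [hX.sum_map_eq, lintegral_smul_measure, smul_eq_mul]

theorem measure_count_eq_zero (hX : IsPoissonProcess P l X) {B : Set Plane}
    (hB : MeasurableSet B) (hv : volume B ≠ ∞) :
    P {ω | countingMeasure (fun i => X i ω) B = 0} =
      ENNReal.ofReal (Real.exp (-(ENNReal.ofReal l * volume B).toReal)) := by
  have h := congrArg (fun μ : Measure ℝ≥0∞ => μ {0}) (hX.map_count B hB hv)
  rw [Measure.map_apply (hX.measurable_count hB) (measurableSet_singleton _),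
    Measure.map_apply .of_discrete (measurableSet_singleton _)] at h
  have hz : (fun k : ℕ => (k : ℝ≥0∞)) ⁻¹' {0} = {0} := by ext k; simp
  rw [hz, poissonMeasure_singleton] at h
  simp only [pow_zero, mul_one, Nat.factorial_zero, Nat.cast_one, div_one] at h
  exact h

theorem ae_count_ne_top (hX : IsPoissonProcess P l X) {B : Set Plane}
    (hB : MeasurableSet B) (hv : volume B ≠ ∞) :
    ∀ᵐ ω ∂P, countingMeasure (fun i => X i ω) B ≠ ∞ := by
  have : ∫⁻ ω, countingMeasure (fun i => X i ω) B ∂P ≠ ∞ := by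
    rw [hX.lintegral_count hB hv]
    exact ENNReal.mul_ne_top ENNReal.ofReal_ne_top hv
  filter_upwards [ae_lt_top (hX.measurable_count hB) this] with ω hω using hω.ne

end IsPoissonProcess

/-! ### The nearest base station -/

/-- Finiteness of the count matters: with infinitely many points in the ball the least norm need not
be attained, and `servingIndex` could take its default value. -/
theorem norm_servingIndex_lt {x : ℕ → Plane} {d : ℝ}
    (h0 : countingMeasure x (Metric.ball 0 d) ≠ 0)
    (ht : countingMeasure x (Metric.ball 0 d) ≠ ∞) : ‖x (servingIndex x)‖ < d := by
  rw [countingMeasure_apply _ measurableSet_ball] at h0 ht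
  have hfin : {i | ‖x i‖ < d}.Finite := by
    have := ENNReal.finite_const_le_of_tsum_ne_top ht one_ne_zero
    refine this.subset fun i hi => ?_
    have hi' : x i ∈ Metric.ball (0 : Plane) d := by simpa using hi
    simp [indicator_of_mem hi']
  have hne : {i | ‖x i‖ < d}.Nonempty := by
    by_contra hemp
    refine h0 (ENNReal.tsum_eq_zero.2 fun i => indicator_of_notMem ?_ _)
    intro hi
    exact hemp ⟨i, by simpa using hi⟩
  obtain ⟨n, hn, hmin⟩ := hfin.exists_minimalFor (fun i => ‖x i‖) _ hne
  have hn' : n ∈ {i | ∀ j, ‖x i‖ ≤ ‖x j‖} := by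
    intro j
    by_cases hj : ‖x j‖ < d
    · rcases le_total ‖x n‖ ‖x j‖ with h | h
      · exact h
      · exact hmin hj h
    · exact (lt_of_lt_of_le hn (not_lt.1 hj)).le
  have := Nat.sInf_mem ⟨n, hn'⟩
  exact lt_of_le_of_lt (this n) hn

theorem measurable_servingIndex : Measurable servingIndex := by
  have hS : ∀ i, MeasurableSet {x : ℕ → Plane | ∀ j, ‖x i‖ ≤ ‖x j‖} := fun i => by
    rw [ofPred_forall]
    exact MeasurableSet.iInter fun j => measurableSet_le (by fun_prop) (by fun_prop)
  refine measurable_of_Iic fun n => ?_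
  -- The last set collects configurations without a nearest point, where `sInf ∅ = 0` lies in every
  -- `Iic n`.
  have : servingIndex ⁻¹' Iic n = (⋃ i ∈ Iic n, {x : ℕ → Plane | ∀ j, ‖x i‖ ≤ ‖x j‖}) ∪
      ⋂ i, {x : ℕ → Plane | ∀ j, ‖x i‖ ≤ ‖x j‖}ᶜ := by
    ext x
    simp only [mem_preimage, mem_Iic, mem_union, mem_iUnion, mem_iInter, mem_compl_iff,
      mem_ofPred_eq, exists_prop]
    constructor
    · intro hx
      rcases ({i | ∀ j, ‖x i‖ ≤ ‖x j‖} : Set ℕ).eq_empty_or_nonempty with he | hne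
      · exact Or.inr fun i hi => (he ▸ (show i ∈ {i | ∀ j, ‖x i‖ ≤ ‖x j‖} from hi) : i ∈ (∅ : Set ℕ))
      · exact Or.inl ⟨_, hx, Nat.sInf_mem hne⟩
    · rintro (⟨i, hi, hx⟩ | hx)
      · exact (Nat.sInf_le (s := {i | ∀ j, ‖x i‖ ≤ ‖x j‖}) hx).trans hi
      · have : ({i | ∀ j, ‖x i‖ ≤ ‖x j‖} : Set ℕ) = ∅ := eq_empty_of_forall_notMem hx
        simp [servingIndex, this]
  rw [this]
  exact (MeasurableSet.biUnion (to_countable _) fun i _ => hS i).union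
    (MeasurableSet.iInter fun i => (hS i).compl)

theorem measurable_eval_nat {β : Type*} [MeasurableSpace β] :
    Measurable fun p : (ℕ → β) × ℕ => p.1 p.2 :=
  measurable_from_prod_countable_left fun n => measurable_pi_apply n

theorem measurable_servingDistance : Measurable fun x : ℕ → Plane => ‖x (servingIndex x)‖ :=
  measurable_norm.comp
    (measurable_eval_nat.comp (measurable_id.prodMk measurable_servingIndex))

/-! ### Path loss averaged over link states -/

/-- The path loss at distance `r`, averaged over the state of the link. -/
noncomputable def meanPathLoss {S : Type*} [MeasurableSpace S] (κ : Measure S) (L : ℝ → S → ℝ) (r : ℝ) : ℝ≥0∞ :=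
  ∫⁻ s, ENNReal.ofReal (L r s) ∂κ

namespace IsFeasiblePathLoss

variable {S : Type*} [MeasurableSpace S] {κ : Measure S} [IsProbabilityMeasure κ]
  {L : ℝ → S → ℝ} {L₀ : ℝ}

theorem measurable_meanPathLoss (hL : IsFeasiblePathLoss κ L L₀) :
    Measurable (meanPathLoss κ L) :=
  Measurable.lintegral_prod_right' (f := fun p : ℝ × S => ENNReal.ofReal (L p.1 p.2))
    hL.measurable.ennreal_ofReal

theorem lintegral_meanPathLoss (hL : IsFeasiblePathLoss κ L L₀) :
    ∫⁻ x : Plane, meanPathLoss κ L ‖x‖ = ENNReal.ofReal (2 * Real.pi) * pathLossGamma κ L := by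
  have hm : Measurable fun p : ℝ × S => ENNReal.ofReal (L p.1 p.2) :=
    hL.measurable.ennreal_ofReal
  rw [lintegral_fun_norm_plane hL.measurable_meanPathLoss]
  congr 1
  calc ∫⁻ r in Ioi (0 : ℝ), ENNReal.ofReal r * meanPathLoss κ L r
      = ∫⁻ r in Ioi (0 : ℝ), ∫⁻ s, ENNReal.ofReal r * ENNReal.ofReal (L r s) ∂κ :=
        lintegral_congr fun r =>
          (lintegral_const_mul _ (hm.comp measurable_prodMk_left)).symm
    _ = ∫⁻ s, (∫⁻ r in Ioi (0 : ℝ), ENNReal.ofReal r * ENNReal.ofReal (L r s)) ∂κ :=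
        lintegral_lintegral_swap
          ((measurable_fst.ennreal_ofReal.mul hm).aemeasurable)
    _ = pathLossGamma κ L := by
        refine lintegral_congr fun s => setLIntegral_congr_fun measurableSet_Ioi fun r hr => ?_
        exact (ENNReal.ofReal_mul (le_of_lt hr)).symm

theorem tendsto_meanPathLoss (hL : IsFeasiblePathLoss κ L L₀)
    (hc : ∀ᵐ s ∂κ, Tendsto (fun r => L r s) (𝓝[>] 0) (𝓝 L₀)) :
    Tendsto (meanPathLoss κ L) (𝓝[>] 0) (𝓝 (ENNReal.ofReal L₀)) := by
  have h := tendsto_lintegral_filter_of_dominated_convergence (μ := κ) (l := 𝓝[>] (0 : ℝ))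
    (F := fun r s => ENNReal.ofReal (L r s)) (f := fun _ => ENNReal.ofReal L₀)
    (fun _ => ENNReal.ofReal L₀)
    (Eventually.of_forall fun r => hL.measurable.ennreal_ofReal.comp measurable_prodMk_left)
    (by
      filter_upwards [self_mem_nhdsWithin] with r hr
      filter_upwards [hL.le] with s hs
      exact ENNReal.ofReal_le_ofReal (hs r (le_of_lt hr)))
    (by simp)
    (by
      filter_upwards [hc] with s hs
      exact ENNReal.tendsto_ofReal hs)
  simp only [lintegral_const, measure_univ, mul_one] at h
  exact h

theorem nonneg_const (hL : IsFeasiblePathLoss κ L L₀) : 0 ≤ L₀ := by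
  obtain ⟨s, h0, h1⟩ := (hL.nonneg.and hL.at_zero).exists
  exact h1 ▸ h0 0 le_rfl

theorem pos_const (hL : IsFeasiblePathLoss κ L L₀) : 0 < L₀ := by
  refine lt_of_le_of_ne hL.nonneg_const fun h0 => hL.gamma_pos.ne' ?_
  refine (lintegral_congr_ae ?_).trans lintegral_zero
  filter_upwards [hL.le] with s hs
  refine (setLIntegral_congr_fun measurableSet_Ioi fun r hr => ?_).trans lintegral_zero
  exact ENNReal.ofReal_of_nonpos
    (mul_nonpos_of_nonneg_of_nonpos (le_of_lt hr) (h0 ▸ hs r (le_of_lt hr)))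

theorem exists_le_meanPathLoss (hL : IsFeasiblePathLoss κ L L₀)
    (hc : ∀ᵐ s ∂κ, Tendsto (fun r => L r s) (𝓝[>] 0) (𝓝 L₀)) {ε : ℝ} (hε : 0 < ε) :
    ∃ d > 0, ∀ r, 0 ≤ r → r < d → ENNReal.ofReal (L₀ - ε) ≤ meanPathLoss κ L r := by
  have hlt : ENNReal.ofReal (L₀ - ε) < ENNReal.ofReal L₀ :=
    (ENNReal.ofReal_lt_ofReal_iff hL.pos_const).2 (by linarith)
  have hev := (hL.tendsto_meanPathLoss hc).eventually (lt_mem_nhds hlt)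
  obtain ⟨d, hd, hd'⟩ := mem_nhdsGT_iff_exists_Ioo_subset.1 hev
  refine ⟨d, hd, fun r hr hrd => ?_⟩
  -- The one-sided limit says nothing at `r = 0`; there `at_zero` is used.
  rcases hr.eq_or_lt with rfl | hr
  · have : meanPathLoss κ L 0 = ENNReal.ofReal L₀ := by
      have : meanPathLoss κ L 0 = ∫⁻ _, ENNReal.ofReal L₀ ∂κ := by
        refine lintegral_congr_ae ?_
        filter_upwards [hL.at_zero] with s hs
        rw [hs]
      simpa using this
    rw [this]
    exact hlt.le
  · exact le_of_lt (hd' ⟨hr, hrd⟩)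

end IsFeasiblePathLoss

/-! ### Pointwise lower bound for the logarithm -/

/-- Combines `log u ≥ 1 - 1/u` with the tangent to `1/w` at `w = m`. Here `A` is the true signal and
`a` its truncation. -/
theorem two_mul_div_le_log_add {A a y N m : ℝ} (ha : 0 ≤ a) (haA : a ≤ A) (hy : 0 ≤ y)
    (hN : 0 < N) (hm : 0 < m) :
    2 / m * a ≤ Real.log (1 + A / (y + N)) + a * (a + N) / m ^ 2 + a * y / m ^ 2 := by
  have hyN : 0 < y + N := by linarith
  have hw : 0 < a + y + N := by linarith
  have h1 : a / (a + y + N) ≤ Real.log (1 + A / (y + N)) := by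
    have hpos : 0 < 1 + a / (y + N) := by positivity
    have hle : Real.log (1 + a / (y + N)) ≤ Real.log (1 + A / (y + N)) := by gcongr
    refine le_trans (le_of_eq ?_) ((Real.one_sub_inv_le_log_of_pos hpos).trans hle)
    have : (1 + a / (y + N)) = (a + y + N) / (y + N) := by field_simp; ring
    rw [this, inv_div]
    field_simp
    ring
  have h2 : 2 / m ≤ 1 / (a + y + N) + (a + y + N) / m ^ 2 := by
    have : 1 / (a + y + N) + (a + y + N) / m ^ 2 - 2 / m
        = (m - (a + y + N)) ^ 2 / ((a + y + N) * m ^ 2) := by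
      field_simp
      ring
    have h3 : 0 ≤ (m - (a + y + N)) ^ 2 / ((a + y + N) * m ^ 2) := by positivity
    linarith
  calc 2 / m * a ≤ (1 / (a + y + N) + (a + y + N) / m ^ 2) * a := by gcongr
    _ = a / (a + y + N) + a * (a + N) / m ^ 2 + a * y / m ^ 2 := by field_simp; ring
    _ ≤ _ := by gcongr

theorem ofReal_le_ofReal_log_add {A a N m : ℝ} {I : ℝ≥0∞} (ha : 0 ≤ a) (haA : a ≤ A)
    (hN : 0 < N) (hm : 0 < m) :
    ENNReal.ofReal (2 / m) * ENNReal.ofReal a ≤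
      ENNReal.ofReal (Real.log (1 + (ENNReal.ofReal A / (I + ENNReal.ofReal N)).toReal)) +
        ENNReal.ofReal (a * (a + N) / m ^ 2) +
        ENNReal.ofReal (1 / m ^ 2) * (ENNReal.ofReal a * I) := by
  -- For `a > 0` infinite interference makes the right side infinite; for `a = 0` that argument
  -- fails, since `0 * ∞ = 0`, but the left side vanishes.
  rcases ha.eq_or_lt with rfl | ha'
  · simp
  by_cases hI : I = ∞
  · subst hI
    have h1 : ENNReal.ofReal (1 / m ^ 2) ≠ 0 := by
      rw [Ne, ENNReal.ofReal_eq_zero, not_le]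
      positivity
    rw [ENNReal.mul_top (by simpa using ha'), ENNReal.mul_top h1, add_top]
    exact le_top
  · lift I to ℝ≥0 using hI
    have hr : (ENNReal.ofReal A / ((I : ℝ≥0∞) + ENNReal.ofReal N)).toReal = A / (I + N) := by
      rw [ENNReal.toReal_div, ENNReal.toReal_ofReal (ha.trans haA),
        ENNReal.toReal_add ENNReal.coe_ne_top ENNReal.ofReal_ne_top,
        ENNReal.toReal_ofReal hN.le, ENNReal.coe_toReal]
    have hlog : 0 ≤ Real.log (1 + A / (I + N)) := by
      refine Real.log_nonneg ?_
      have : 0 ≤ A / (I + N) := div_nonneg (ha.trans haA) (by positivity)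
      linarith
    rw [hr, ← ENNReal.ofReal_coe_nnreal (p := I), ← ENNReal.ofReal_mul ha,
      ← ENNReal.ofReal_mul (by positivity), ← ENNReal.ofReal_mul (by positivity),
      ← ENNReal.ofReal_add hlog (by positivity),
      ← ENNReal.ofReal_add (by positivity) (by positivity)]
    refine ENNReal.ofReal_le_ofReal ((two_mul_div_le_log_add ha haA I.2 hN hm).trans_eq ?_)
    simp only [NNReal.val_eq_coe]
    ring

/-! ### Freezing the positions: Fubini and measurability -/

theorem measurable_lintegral_comp_prodMk {Ω α β : Type*} [MeasurableSpace Ω] [MeasurableSpace α]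
    [MeasurableSpace β] {P : Measure Ω} [SFinite P] {f : Ω → α} {g : Ω → β}
    (hf : Measurable f) (hg : Measurable g) {F : α × β → ℝ≥0∞} (hF : Measurable F) :
    Measurable fun ω => ∫⁻ ω', F (f ω, g ω') ∂P :=
  Measurable.lintegral_prod_right' (f := fun q : Ω × Ω => F (f q.1, g q.2))
    (hF.comp ((hf.comp measurable_fst).prodMk (hg.comp measurable_snd)))

theorem lintegral_comp_prodMk_of_indepFun {Ω α β : Type*} [MeasurableSpace Ω] [MeasurableSpace α]
    [MeasurableSpace β] {P : Measure Ω} [IsFiniteMeasure P] {f : Ω → α} {g : Ω → β}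
    (hf : Measurable f) (hg : Measurable g) (hfg : IndepFun f g P) {F : α × β → ℝ≥0∞}
    (hF : Measurable F) :
    ∫⁻ ω, F (f ω, g ω) ∂P = ∫⁻ ω, ∫⁻ ω', F (f ω, g ω') ∂P ∂P := by
  rw [← lintegral_map (f := F) (g := fun ω => (f ω, g ω)) hF (hf.prodMk hg),
    hfg.map_prod_eq_prod_map_map hf.aemeasurable hg.aemeasurable,
    lintegral_prod _ hF.aemeasurable, lintegral_map hF.lintegral_prod_right' hf]
  exact lintegral_congr fun ω => lintegral_map (hF.comp measurable_prodMk_left) hg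

theorem measurable_sinr {S : Type*} [MeasurableSpace S] {L : ℝ → S → ℝ}
    (hL : Measurable (Function.uncurry L)) (N₀ : ℝ) :
    Measurable fun p : (ℕ → Plane) × ((ℕ → ℝ) × (ℕ → S)) => sinr L N₀ p.1 p.2.1 p.2.2 := by
  have hn : Measurable fun p : (ℕ → Plane) × ((ℕ → ℝ) × (ℕ → S)) => servingIndex p.1 :=
    measurable_servingIndex.comp measurable_fst
  have hd : Measurable fun p : (ℕ → Plane) × ((ℕ → ℝ) × (ℕ → S)) => ‖p.1 (servingIndex p.1)‖ :=
    measurable_servingDistance.comp measurable_fst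
  have hh : Measurable fun p : (ℕ → Plane) × ((ℕ → ℝ) × (ℕ → S)) => p.2.1 (servingIndex p.1) :=
    measurable_eval_nat.comp ((measurable_fst.comp measurable_snd).prodMk hn)
  have hz : Measurable fun p : (ℕ → Plane) × ((ℕ → ℝ) × (ℕ → S)) => p.2.2 (servingIndex p.1) :=
    measurable_eval_nat.comp ((measurable_snd.comp measurable_snd).prodMk hn)
  refine Measurable.div (hh.mul (hL.comp (hd.prodMk hz))).ennreal_ofReal
    (Measurable.add (Measurable.tsum fun i => ?_) measurable_const)
  have hr : Measurable fun p : (ℕ → Plane) × ((ℕ → ℝ) × (ℕ → S)) => ‖p.1 i‖ := by fun_prop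
  have hzi : Measurable fun p : (ℕ → Plane) × ((ℕ → ℝ) × (ℕ → S)) => p.2.2 i := by fun_prop
  have hhi : Measurable fun p : (ℕ → Plane) × ((ℕ → ℝ) × (ℕ → S)) => p.2.1 i := by fun_prop
  exact Measurable.ite (measurableSet_lt hd hr)
    (hhi.mul (hL.comp (hr.prodMk hzi))).ennreal_ofReal measurable_const

/-! ### Truncated fading -/

/-- The mean of the fading power truncated at `K`. -/
noncomputable def truncatedMean (H : Measure ℝ) (K : ℝ) : ℝ := ∫ t, min t K ∂H

namespace IsUnitMeanFading

variable {H : Measure ℝ}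

theorem lintegral_ofReal (hH : IsUnitMeanFading H) : ∫⁻ t, ENNReal.ofReal t ∂H = 1 := by
  rw [← ofReal_integral_eq_lintegral_ofReal hH.integrable hH.nonneg, hH.mean, ENNReal.ofReal_one]

theorem integrable_min [IsFiniteMeasure H] (hH : IsUnitMeanFading H) (K : ℝ) :
    Integrable (fun t : ℝ => min t K) H :=
  hH.integrable.inf (integrable_const K)

theorem truncatedMean_nonneg (hH : IsUnitMeanFading H) {K : ℝ} (hK : 0 ≤ K) :
    0 ≤ truncatedMean H K :=
  integral_nonneg_of_ae (by filter_upwards [hH.nonneg] with t ht using le_min ht hK)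

theorem lintegral_ofReal_min [IsFiniteMeasure H] (hH : IsUnitMeanFading H) {K : ℝ} (hK : 0 ≤ K) :
    ∫⁻ t, ENNReal.ofReal (min t K) ∂H = ENNReal.ofReal (truncatedMean H K) :=
  (ofReal_integral_eq_lintegral_ofReal (hH.integrable_min K)
    (by filter_upwards [hH.nonneg] with t ht using le_min ht hK)).symm

theorem tendsto_truncatedMean [IsFiniteMeasure H] (hH : IsUnitMeanFading H) :
    Tendsto (truncatedMean H) atTop (𝓝 1) := by
  rw [← hH.mean]
  refine tendsto_integral_filter_of_dominated_convergence (fun t => t)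
    (Eventually.of_forall fun K => (hH.integrable_min K).aestronglyMeasurable) ?_ hH.integrable ?_
  · filter_upwards [eventually_ge_atTop 0] with K hK
    filter_upwards [hH.nonneg] with t ht
    rw [Real.norm_of_nonneg (le_min ht hK)]
    exact min_le_left _ _
  · refine Eventually.of_forall fun t => tendsto_const_nhds.congr' ?_
    filter_upwards [eventually_ge_atTop t] with K hK using (min_eq_left hK).symm

end IsUnitMeanFading

/-- The ball of radius `d` is nonempty with probability `1 - exp(-lπd²)`, and then the serving
station lies in it. -/
theorem IsPoissonProcess.mul_le_lintegral_servingDistance {Ω : Type*} [MeasurableSpace Ω]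
    {P : Measure Ω} [IsProbabilityMeasure P] {l : ℝ} (hl : 0 < l) {X : ℕ → Ω → Plane}
    (hX : IsPoissonProcess P l X) {g : ℝ → ℝ≥0∞} {c d : ℝ} (hd : 0 < d)
    (hg : ∀ r, 0 ≤ r → r < d → ENNReal.ofReal c ≤ g r) :
    ENNReal.ofReal c * ENNReal.ofReal (1 - Real.exp (-(l * (Real.pi * d ^ 2)))) ≤
      ∫⁻ ω, g ‖X (servingIndex fun i => X i ω) ω‖ ∂P := by
  set B : Set Plane := Metric.ball 0 d
  have hv : volume B ≠ ∞ := measure_ball_lt_top.ne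
  have hvol : (ENNReal.ofReal l * volume B).toReal = l * (Real.pi * d ^ 2) := by
    rw [EuclideanSpace.volume_ball_fin_two, ENNReal.toReal_mul, ENNReal.toReal_ofReal hl.le]
    simp [hd.le, Real.pi_pos.le, mul_comm]
  have hE : MeasurableSet {ω | countingMeasure (fun i => X i ω) B = 0} :=
    hX.measurable_count measurableSet_ball (measurableSet_singleton 0)
  have hP : P {ω | countingMeasure (fun i => X i ω) B = 0}ᶜ =
      ENNReal.ofReal (1 - Real.exp (-(l * (Real.pi * d ^ 2)))) := by
    rw [prob_compl_eq_one_sub hE, hX.measure_count_eq_zero measurableSet_ball hv, hvol,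
      ENNReal.ofReal_sub _ (Real.exp_pos _).le, ENNReal.ofReal_one]
  rw [← hP, ← lintegral_indicator_const hE.compl]
  refine lintegral_mono_ae ?_
  filter_upwards [hX.ae_count_ne_top measurableSet_ball hv] with ω hω
  by_cases h0 : countingMeasure (fun i => X i ω) B = 0
  · rw [indicator_of_notMem (by simpa using h0)]
    exact zero_le
  · rw [indicator_of_mem (by simpa using h0)]
    exact hg ‖X (servingIndex fun i => X i ω) ω‖ (norm_nonneg _)
      (norm_servingIndex_lt (x := fun i => X i ω) h0 hω)

/-! ### Expectations over fading, states and positions -/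

namespace IsDownlinkNetwork

variable {Ω S : Type*} [MeasurableSpace Ω] [MeasurableSpace S] {P : Measure Ω}
  {H : Measure ℝ} {κ : Measure S} {L : ℝ → S → ℝ} {L₀ N₀ l : ℝ}
  {X : ℕ → Ω → Plane} {h : ℕ → Ω → ℝ} {z : ℕ → Ω → S}

theorem lintegral_fading_mul_pathLoss (hnet : IsDownlinkNetwork P H κ l X h z)
    (hL : IsFeasiblePathLoss κ L L₀) {φ : (ℕ → ℝ) → ℝ≥0∞} (hφ : Measurable φ) (r : ℝ) (i : ℕ) :
    ∫⁻ ω, φ (fun j => h j ω) * ENNReal.ofReal (L r (z i ω)) ∂P =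
      (∫⁻ ω, φ (fun j => h j ω) ∂P) * meanPathLoss κ L r := by
  have hLr : Measurable fun s => ENNReal.ofReal (L r s) :=
    hL.measurable.ennreal_ofReal.comp measurable_prodMk_left
  have hmean : ∫⁻ ω, ENNReal.ofReal (L r (z i ω)) ∂P = meanPathLoss κ L r := by
    rw [meanPathLoss, ← hnet.law_state i, lintegral_map hLr (hnet.measurable_state i)]
  rw [← hmean]
  exact lintegral_mul_eq_lintegral_mul_lintegral_of_indepFun
    (hφ.comp (measurable_pi_lambda _ hnet.measurable_fading))
    (hLr.comp (hnet.measurable_state i))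
    (hnet.indep_fading_state.comp hφ (hLr.comp (measurable_pi_apply i)))

theorem ae_forall_fading (hnet : IsDownlinkNetwork P H κ l X h z) {p : ℝ → Prop}
    (hp : ∀ᵐ t ∂H, p t) : ∀ᵐ ω ∂P, ∀ i, p (h i ω) :=
  ae_all_iff.2 fun i => ae_of_ae_map (hnet.measurable_fading i).aemeasurable
    (by rwa [hnet.law_fading i])

theorem ae_forall_state (hnet : IsDownlinkNetwork P H κ l X h z) {p : S → Prop}
    (hp : ∀ᵐ s ∂κ, p s) : ∀ᵐ ω ∂P, ∀ i, p (z i ω) :=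
  ae_all_iff.2 fun i => ae_of_ae_map (hnet.measurable_state i).aemeasurable
    (by rwa [hnet.law_state i])

theorem lintegral_fading (hnet : IsDownlinkNetwork P H κ l X h z) {φ : ℝ → ℝ≥0∞}
    (hφ : Measurable φ) (i : ℕ) : ∫⁻ ω, φ (h i ω) ∂P = ∫⁻ t, φ t ∂H := by
  rw [← hnet.law_fading i, lintegral_map hφ (hnet.measurable_fading i)]

variable [IsProbabilityMeasure P] [IsProbabilityMeasure H]

/-- With positions fixed, the serving index is a constant, and every interferer has a different
index. The truncated serving fading is thus independent of each interfering one, whose mean is one;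
only first moments appear. -/
theorem lintegral_min_mul_interference_le (hnet : IsDownlinkNetwork P H κ l X h z)
    (hH : IsUnitMeanFading H) (hL : IsFeasiblePathLoss κ L L₀) {K : ℝ} (hK : 0 ≤ K)
    (x : ℕ → Plane) :
    ∫⁻ ω, ENNReal.ofReal (min (h (servingIndex x) ω) K) *
        interference L x (fun i => h i ω) (fun i => z i ω) ∂P ≤
      ENNReal.ofReal (truncatedMean H K) * ∑' i, meanPathLoss κ L ‖x i‖ := by
  set n := servingIndex x with hn
  have hLr : ∀ r, Measurable fun s => L r s := fun r =>
    hL.measurable.comp measurable_prodMk_left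
  have hterm : ∀ i, Measurable fun ω => if ‖x n‖ < ‖x i‖ then
      ENNReal.ofReal (h i ω * L ‖x i‖ (z i ω)) else 0 := fun i =>
    Measurable.ite (MeasurableSet.const _) ((hnet.measurable_fading i).mul
      ((hLr _).comp (hnet.measurable_state i))).ennreal_ofReal measurable_const
  have hmin : Measurable fun ω => ENNReal.ofReal (min (h n ω) K) :=
    ((hnet.measurable_fading n).min measurable_const).ennreal_ofReal
  simp_rw [interference, ← hn, ← ENNReal.tsum_mul_left]
  rw [lintegral_tsum (f := fun i ω => ENNReal.ofReal (min (h n ω) K) * if ‖x n‖ < ‖x i‖ then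
      ENNReal.ofReal (h i ω * L ‖x i‖ (z i ω)) else 0)
    fun i => (hmin.mul (hterm i)).aemeasurable]
  refine ENNReal.tsum_le_tsum fun i => ?_
  by_cases hi : ‖x n‖ < ‖x i‖
  · have hne : n ≠ i := fun hne => by simp [hne] at hi
    simp only [hi, if_true]
    let φ : (ℕ → ℝ) → ℝ≥0∞ := fun f => ENNReal.ofReal (min (f n) K) * ENNReal.ofReal (f i)
    have hφ : Measurable φ :=
      ((measurable_pi_apply n).min measurable_const).ennreal_ofReal.mul
        (measurable_pi_apply i).ennreal_ofReal
    have hmK : Measurable fun t : ℝ => ENNReal.ofReal (min t K) :=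
      (measurable_id.min measurable_const).ennreal_ofReal
    have hφE : ∫⁻ ω, φ (fun j => h j ω) ∂P = ENNReal.ofReal (truncatedMean H K) := by
      have hind := (hnet.indep_fading.indepFun hne).comp hmK ENNReal.measurable_ofReal
      have := lintegral_mul_eq_lintegral_mul_lintegral_of_indepFun hmin
        (hnet.measurable_fading i).ennreal_ofReal hind
      refine this.trans ?_
      rw [hnet.lintegral_fading hmK n, hnet.lintegral_fading ENNReal.measurable_ofReal i,
        hH.lintegral_ofReal, hH.lintegral_ofReal_min hK, mul_one]
    rw [← hφE, ← hnet.lintegral_fading_mul_pathLoss hL hφ _ i]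
    refine (lintegral_congr_ae ?_).le
    filter_upwards [hnet.ae_forall_fading hH.nonneg] with ω hω
    rw [ENNReal.ofReal_mul (hω i), ← mul_assoc]
  · simp [hi]

variable [IsProbabilityMeasure κ]

/-- For fixed positions of the base stations, a lower bound on the mean of `log (1 + SINR)`. -/
theorem meanPathLoss_le_lintegral_log_add (hnet : IsDownlinkNetwork P H κ l X h z)
    (hH : IsUnitMeanFading H) (hL : IsFeasiblePathLoss κ L L₀) (hN₀ : 0 < N₀) {K m : ℝ}
    (hK : 0 ≤ K) (hm : 0 < m) (x : ℕ → Plane) :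
    ENNReal.ofReal (2 / m) *
        (ENNReal.ofReal (truncatedMean H K) * meanPathLoss κ L ‖x (servingIndex x)‖) ≤
      ∫⁻ ω, ENNReal.ofReal (Real.log
          (1 + (sinr L N₀ x (fun i => h i ω) (fun i => z i ω)).toReal)) ∂P +
        ENNReal.ofReal (K * L₀ * (K * L₀ + N₀) / m ^ 2) +
        ENNReal.ofReal (1 / m ^ 2) * (ENNReal.ofReal L₀ *
          (ENNReal.ofReal (truncatedMean H K) * ∑' i, meanPathLoss κ L ‖x i‖)) := by
  set n := servingIndex x with hn
  have hL₀ := hL.nonneg_const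
  have hmarks : Measurable fun ω => ((fun i => h i ω), (fun i => z i ω)) :=
    (measurable_pi_lambda _ hnet.measurable_fading).prodMk
      (measurable_pi_lambda _ hnet.measurable_state)
  have hlog : Measurable fun ω => ENNReal.ofReal (Real.log
      (1 + (sinr L N₀ x (fun i => h i ω) (fun i => z i ω)).toReal)) :=
    (Real.measurable_log.comp (((measurable_sinr hL.measurable N₀).comp
      (measurable_prodMk_left.comp hmarks)).ennreal_toReal.const_add 1)).ennreal_ofReal
  let φ : (ℕ → ℝ) → ℝ≥0∞ := fun f => ENNReal.ofReal (min (f n) K)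
  have hmK : Measurable fun t : ℝ => ENNReal.ofReal (min t K) :=
    (measurable_id.min measurable_const).ennreal_ofReal
  have hφ : Measurable φ := hmK.comp (measurable_pi_apply n)
  have hsignal : ∫⁻ ω, φ (fun j => h j ω) * ENNReal.ofReal (L ‖x n‖ (z n ω)) ∂P =
      ENNReal.ofReal (truncatedMean H K) * meanPathLoss κ L ‖x n‖ := by
    rw [hnet.lintegral_fading_mul_pathLoss hL hφ, hnet.lintegral_fading hmK n,
      hH.lintegral_ofReal_min hK]
  rw [← hsignal, ← lintegral_const_mul' _ _ ENNReal.ofReal_ne_top]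
  calc ∫⁻ ω, ENNReal.ofReal (2 / m) * (φ (fun j => h j ω) * ENNReal.ofReal (L ‖x n‖ (z n ω))) ∂P
      ≤ ∫⁻ ω, (ENNReal.ofReal (Real.log
          (1 + (sinr L N₀ x (fun i => h i ω) (fun i => z i ω)).toReal)) +
        ENNReal.ofReal (K * L₀ * (K * L₀ + N₀) / m ^ 2)) +
        ENNReal.ofReal (1 / m ^ 2) * (ENNReal.ofReal L₀ * (ENNReal.ofReal (min (h n ω) K) *
          interference L x (fun i => h i ω) (fun i => z i ω))) ∂P := by
        refine lintegral_mono_ae ?_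
        filter_upwards [hnet.ae_forall_fading hH.nonneg, hnet.ae_forall_state hL.nonneg,
          hnet.ae_forall_state hL.le] with ω hh hz0 hz1
        have h0 : 0 ≤ L ‖x n‖ (z n ω) := hz0 n _ (norm_nonneg _)
        have h1 : L ‖x n‖ (z n ω) ≤ L₀ := hz1 n _ (norm_nonneg _)
        have hmn : 0 ≤ min (h n ω) K := le_min (hh n) hK
        have hle : min (h n ω) K * L ‖x n‖ (z n ω) ≤ K * L₀ :=
          mul_le_mul (min_le_right _ _) h1 h0 hK
        have ha : 0 ≤ min (h n ω) K * L ‖x n‖ (z n ω) := mul_nonneg hmn h0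
        refine le_trans (le_of_eq ?_) ((ofReal_le_ofReal_log_add
          (I := interference L x (fun i => h i ω) (fun i => z i ω)) ha
          (mul_le_mul_of_nonneg_right (min_le_left (h n ω) K) h0) hN₀ hm).trans ?_)
        · rw [ENNReal.ofReal_mul hmn]
        -- The quadratic term may be bounded crudely by `a ≤ K * L₀`, as it vanishes in the limit.
        -- The interference term survives, so there only the path loss is bounded and `min (h n ω)
        -- K` is kept for its mean.
        · rw [← mul_assoc (ENNReal.ofReal L₀), ← ENNReal.ofReal_mul hL₀, mul_comm L₀]
          exact add_le_add (add_le_add le_rfl (ENNReal.ofReal_le_ofReal (by gcongr))) (by gcongr)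
    _ = _ := by
        rw [lintegral_add_left (hlog.add_const _), lintegral_add_left hlog, lintegral_const,
          measure_univ, mul_one, lintegral_const_mul' _ _ ENNReal.ofReal_ne_top,
          lintegral_const_mul' _ _ ENNReal.ofReal_ne_top]
    _ ≤ _ := by
        gcongr
        exact hnet.lintegral_min_mul_interference_le hH hL hK x

theorem lintegral_meanPathLoss_le (hnet : IsDownlinkNetwork P H κ l X h z)
    (hH : IsUnitMeanFading H) (hL : IsFeasiblePathLoss κ L L₀) (hN₀ : 0 < N₀) {K m : ℝ}
    (hK : 0 ≤ K) (hm : 0 < m) :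
    ENNReal.ofReal (2 / m) * (ENNReal.ofReal (truncatedMean H K) *
        ∫⁻ ω, meanPathLoss κ L ‖X (servingIndex fun i => X i ω) ω‖ ∂P) ≤
      ∫⁻ ω, ENNReal.ofReal (Real.log
          (1 + (sinr L N₀ (fun i => X i ω) (fun i => h i ω) (fun i => z i ω)).toReal)) ∂P +
        ENNReal.ofReal (K * L₀ * (K * L₀ + N₀) / m ^ 2) +
        ENNReal.ofReal (1 / m ^ 2) * (ENNReal.ofReal L₀ * (ENNReal.ofReal (truncatedMean H K) *
          (ENNReal.ofReal l * (ENNReal.ofReal (2 * Real.pi) * pathLossGamma κ L)))) := by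
  have hX : Measurable fun ω i => X i ω := measurable_pi_lambda _ hnet.poisson.measurable
  have hmarks : Measurable fun ω => ((fun i => h i ω), (fun i => z i ω)) :=
    (measurable_pi_lambda _ hnet.measurable_fading).prodMk
      (measurable_pi_lambda _ hnet.measurable_state)
  have hlog : Measurable fun p : (ℕ → Plane) × ((ℕ → ℝ) × (ℕ → S)) =>
      ENNReal.ofReal (Real.log (1 + (sinr L N₀ p.1 p.2.1 p.2.2).toReal)) :=
    (Real.measurable_log.comp
      ((measurable_sinr hL.measurable N₀).ennreal_toReal.const_add 1)).ennreal_ofReal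
  have hinner : Measurable fun ω => ∫⁻ ω', ENNReal.ofReal (Real.log
      (1 + (sinr L N₀ (fun i => X i ω) (fun i => h i ω') (fun i => z i ω')).toReal)) ∂P :=
    measurable_lintegral_comp_prodMk hX hmarks hlog
  have hcampbell := hnet.poisson.lintegral_tsum_eq
    (hL.measurable_meanPathLoss.comp measurable_norm)
  simp only [Function.comp_def] at hcampbell
  rw [hL.lintegral_meanPathLoss] at hcampbell
  have hsplit : ∫⁻ ω, ENNReal.ofReal (Real.log
      (1 + (sinr L N₀ (fun i => X i ω) (fun i => h i ω) (fun i => z i ω)).toReal)) ∂P =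
      ∫⁻ ω, ∫⁻ ω', ENNReal.ofReal (Real.log
        (1 + (sinr L N₀ (fun i => X i ω) (fun i => h i ω') (fun i => z i ω')).toReal)) ∂P ∂P :=
    lintegral_comp_prodMk_of_indepFun hX hmarks hnet.indep_position_marks hlog
  rw [hsplit, ← hcampbell]
  have hmono := lintegral_mono (μ := P) fun ω =>
    hnet.meanPathLoss_le_lintegral_log_add hH hL hN₀ hK hm (fun i => X i ω)
  rw [lintegral_add_left (hinner.add_const _), lintegral_add_left hinner, lintegral_const,
    measure_univ, mul_one] at hmono
  simpa only [lintegral_const_mul' _ _ ENNReal.ofReal_ne_top] using hmono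

end IsDownlinkNetwork

/-! ### The finite-intensity bound and the limit -/

theorem averageASE_eq {Ω S : Type*} [MeasurableSpace Ω] (P : Measure Ω) (L : ℝ → S → ℝ)
    (N₀ : ℝ) {l : ℝ} (hl : 0 < l) (X : ℕ → Ω → Plane) (h : ℕ → Ω → ℝ) (z : ℕ → Ω → S) :
    averageASE P L N₀ l X h z = ENNReal.ofReal (l / Real.log 2) * ∫⁻ ω, ENNReal.ofReal (Real.log
      (1 + (sinr L N₀ (fun i => X i ω) (fun i => h i ω) (fun i => z i ω)).toReal)) ∂P := by
  have hlog2 : 0 < Real.log 2 := Real.log_pos one_lt_two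
  rw [averageASE, div_eq_mul_inv, ENNReal.ofReal_mul hl.le, mul_assoc,
    ← lintegral_const_mul' (ENNReal.ofReal (Real.log 2)⁻¹) _ ENNReal.ofReal_ne_top]
  congr 1
  refine lintegral_congr fun ω => ?_
  rw [← ENNReal.ofReal_mul (inv_nonneg.2 hlog2.le), Real.logb, div_eq_inv_mul]

theorem IsDownlinkNetwork.ofReal_le_averageASE {Ω S : Type*} [MeasurableSpace Ω]
    [MeasurableSpace S] {P : Measure Ω} [IsProbabilityMeasure P] {H : Measure ℝ}
    [IsProbabilityMeasure H] {κ : Measure S} [IsProbabilityMeasure κ] {L : ℝ → S → ℝ}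
    {L₀ N₀ l : ℝ} {X : ℕ → Ω → Plane} {h : ℕ → Ω → ℝ} {z : ℕ → Ω → S}
    (hnet : IsDownlinkNetwork P H κ l X h z) (hl : 0 < l) (hH : IsUnitMeanFading H)
    (hL : IsFeasiblePathLoss κ L L₀) (hN₀ : 0 < N₀) {K c d : ℝ} (hK : 0 ≤ K) (hd : 0 < d)
    (hc : ∀ r, 0 ≤ r → r < d → ENNReal.ofReal c ≤ meanPathLoss κ L r) :
    ENNReal.ofReal ((truncatedMean H K * (2 * c * (1 - Real.exp (-(l * (Real.pi * d ^ 2)))) - L₀) -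
        K * L₀ * (K * L₀ + N₀) / (2 * Real.pi * (pathLossGamma κ L).toReal * l)) /
          (2 * Real.pi * Real.log 2 * (pathLossGamma κ L).toReal)) ≤
      averageASE P L N₀ l X h z := by
  have hlog2 : 0 < Real.log 2 := Real.log_pos one_lt_two
  have hγ : 0 < (pathLossGamma κ L).toReal :=
    ENNReal.toReal_pos hL.gamma_pos.ne' hL.gamma_lt_top.ne
  have hγeq := ENNReal.ofReal_toReal hL.gamma_lt_top.ne
  set γ := (pathLossGamma κ L).toReal
  set p := 1 - Real.exp (-(l * (Real.pi * d ^ 2)))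
  set α := truncatedMean H K
  have hα : 0 ≤ α := hH.truncatedMean_nonneg hK
  have hL₀ := hL.nonneg_const
  have hp : 0 ≤ p := sub_nonneg.2 (Real.exp_le_one_iff.2 (neg_nonpos.2 (by positivity)))
  -- The tangent point is the Campbell mean of `∑' i, meanPathLoss κ L ‖X i ω‖`, so the interference
  -- term becomes `L₀ * α / m`.
  have hm : 0 < 2 * Real.pi * γ * l := by positivity
  have hserve := hnet.poisson.mul_le_lintegral_servingDistance hl hd hc
  have hbound := hnet.lintegral_meanPathLoss_le hH hL hN₀ hK hm
  rw [averageASE_eq P L N₀ hl]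
  set J := ∫⁻ ω, ENNReal.ofReal (Real.log
    (1 + (sinr L N₀ (fun i => X i ω) (fun i => h i ω) (fun i => z i ω)).toReal)) ∂P
  set m := 2 * Real.pi * γ * l with hm_def
  have hmean : ENNReal.ofReal l * (ENNReal.ofReal (2 * Real.pi) * pathLossGamma κ L) =
      ENNReal.ofReal m := by
    rw [← hγeq, ← ENNReal.ofReal_mul (by positivity), ← ENNReal.ofReal_mul hl.le, mul_comm l]
  have hJ : ENNReal.ofReal (2 / m * (α * (c * p)) -
      (K * L₀ * (K * L₀ + N₀) / m ^ 2 + 1 / m ^ 2 * (L₀ * (α * m)))) ≤ J := by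
    rw [ENNReal.ofReal_sub _ (by positivity), tsub_le_iff_right,
      ENNReal.ofReal_add (by positivity) (by positivity), ← add_assoc]
    refine le_trans ?_ (hbound.trans_eq ?_)
    -- `c` may be negative, so this product is split using the sign of `p`.
    · rw [ENNReal.ofReal_mul (by positivity), ENNReal.ofReal_mul hα, ENNReal.ofReal_mul' hp]
      gcongr
    · rw [hmean, ← ENNReal.ofReal_mul hα, ← ENNReal.ofReal_mul hL₀,
        ← ENNReal.ofReal_mul (by positivity)]
  refine le_trans (le_of_eq ?_) (mul_le_mul_right hJ (ENNReal.ofReal (l / Real.log 2)))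
  rw [← ENNReal.ofReal_mul (by positivity)]
  congr 1
  rw [hm_def]
  field_simp
  ring

theorem lemma2 {Ω S : Type*} [MeasurableSpace Ω] [MeasurableSpace S]
    (P : Measure Ω) [IsProbabilityMeasure P]
    (H : Measure ℝ) [IsProbabilityMeasure H] (hH : IsUnitMeanFading H)
    (κ : Measure S) [IsProbabilityMeasure κ]
    (L : ℝ → S → ℝ) (L₀ : ℝ) (hL : IsFeasiblePathLoss κ L L₀)
    (hL_cont : ∀ᵐ s ∂κ, Tendsto (fun r => L r s) (𝓝[>] 0) (𝓝 L₀))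
    (N₀ : ℝ) (hN₀ : 0 < N₀)
    (X : ℝ → ℕ → Ω → Plane) (h : ℝ → ℕ → Ω → ℝ) (z : ℝ → ℕ → Ω → S)
    (hnet : ∀ l : ℝ, 0 < l → IsDownlinkNetwork P H κ l (X l) (h l) (z l)) :
    ENNReal.ofReal (L₀ / (2 * Real.pi * Real.log 2 * (pathLossGamma κ L).toReal)) ≤
      liminf (fun l : ℝ => averageASE P L N₀ l (X l) (h l) (z l)) atTop := by
  have hγ : 0 < (pathLossGamma κ L).toReal :=
    ENNReal.toReal_pos hL.gamma_pos.ne' hL.gamma_lt_top.ne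
  have key : ∀ K : ℝ, 0 < K → ENNReal.ofReal ((truncatedMean H K * (2 * (L₀ - K⁻¹) - L₀)) /
      (2 * Real.pi * Real.log 2 * (pathLossGamma κ L).toReal)) ≤
      liminf (fun l : ℝ => averageASE P L N₀ l (X l) (h l) (z l)) atTop := by
    -- One parameter serves twice: truncation level `K` and tolerance `K⁻¹` for the path loss near
    -- zero.
    intro K hK
    obtain ⟨d, hd, hc⟩ := hL.exists_le_meanPathLoss hL_cont (inv_pos.2 hK)
    have hexp : Tendsto (fun l : ℝ => Real.exp (-(l * (Real.pi * d ^ 2)))) atTop (𝓝 0) :=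
      Real.tendsto_exp_neg_atTop_nhds_zero.comp
        (tendsto_id.atTop_mul_const (by positivity))
    have hnoise : Tendsto (fun l : ℝ => K * L₀ * (K * L₀ + N₀) /
        (2 * Real.pi * (pathLossGamma κ L).toReal * l)) atTop (𝓝 0) :=
      tendsto_const_nhds.div_atTop (tendsto_id.const_mul_atTop (by positivity))
    have hlim := ENNReal.tendsto_ofReal
      ((((((hexp.const_sub 1).const_mul (2 * (L₀ - K⁻¹))).sub_const L₀).const_mul
        (truncatedMean H K)).sub hnoise).div_const
          (2 * Real.pi * Real.log 2 * (pathLossGamma κ L).toReal))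
    rw [sub_zero, sub_zero, mul_one] at hlim
    rw [← hlim.liminf_eq]
    refine liminf_le_liminf ?_
    filter_upwards [eventually_gt_atTop 0] with l hl
    exact (hnet l hl).ofReal_le_averageASE hl hH hL hN₀ hK.le hd hc
  have hlim := ENNReal.tendsto_ofReal
    ((hH.tendsto_truncatedMean.mul (((tendsto_inv_atTop_zero.const_sub L₀).const_mul 2).sub_const
      L₀)).div_const (2 * Real.pi * Real.log 2 * (pathLossGamma κ L).toReal))
  rw [show (1 : ℝ) * (2 * (L₀ - 0) - L₀) = L₀ by ring] at hlim
  exact le_of_tendsto hlim ((eventually_gt_atTop 0).mono key)
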